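/- **Corollary 4.3.** A *2-design* consists of a finite set of points and a finite family of blocks (subsets of the point set) such that all blocks have the same number of points and any two distinct points are together in the same number $\lambda$ of blocks. Its *intersection numbers* are the cardinalities of the intersections of pairs of distinct blocks. The design is *quasi-symmetric* if it has exactly two intersection numbers $\lambda_1<\lambda_2$; its *defect* is $\lambda_2-\lambda_1$, and its *block graph* has the blocks as vertices, two distinct blocks being adjacent if and only if they have exactly $\lambda_2$ points in common. Let $K_{m\times n}$ be the complete multipartite graph with $m$ parts of size $n$ each. For $m,n\ge 2$, a *strongly resolvable 2-design* with block graph $K_{m\times n}$ is a quasi-symmetric 2-design whose block graph is isomorphic to $K_{m\times n}$. For a prime $p$ and nonzero rationals $a,b$, the *Hilbert symbol* $(a,b)_p$ is $+1$ if $ax^2+by^2=z^2$ has a solution $(x,y,z)\neq(0,0,0)$ in $\mathbb{Q}_p$, and $-1$ otherwise. Let $m\ge 2$, $n\ge 2$ and $\mu\ge 1$ be integers, and suppose that there exists a strongly resolvable 2-design of defect $\mu$ with block graph $K_{m\times n}$. Then: - (a1) If $m$ is even, then $mn-m+1$ is a perfect square. - (a2) If $m$ is odd and $n$ is even, then $(mn-m+1)\mu$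 is a perfect square. - (a3) If $m$ and $n$ are both odd, then $n(mn-m+1)$ is a perfect square. - (b1) If $m\equiv 2\pmod 4$, then $n$ is a sum of two squares. - (b2) If $m\equiv 3\pmod 4$ and $n\equiv 2\pmod 4$, then $n$ is a sum of two squares. - (b3) If $m\equiv 3\pmod 4$ and $n\equiv 0\pmod 4$, then $mn-m+1$ is a sum of two squares. - (b4) If $m\equiv 1\pmod 4$ and $n\equiv 2\pmod 4$, then $n(mn-m+1)$ is a sum of two squares. - (b5) If $m,n$ are both odd and $m\not\equiv n\pmod 4$, then the equation $\mu x^2+(-1)^{(n-1)/2}\,n\,y^2=z^2$ has a solution $(x,y,z)\ne(0,0,0)$ in integers. - (b6) If $m\equiv n\equiv 1\pmod 4$, then the equation $nx^2-\mu y^2=z^2$ has a solution $(x,y,z)\ne(0,0,0)$ in integers. - (b7) If $m\equiv n\equiv 3\pmod 4$, then $(-\mu,-n)_2=-1$, and $(-\mu,-n)_p=1$ for every odd prime $p$. Here a sum of two squares means $a^2+b^2$ with integers $a,b\ge 0$ (zero allowed). -/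

import Mathlib

/-- The incidence system with point set `P` and blocks `D i`, `i : B` (repeated blocks are allowed),
is a 2-design with parameters `v, k, l`: there are `v` points in total, every block has `k` points,
and any two distinct points are together in exactly `l` blocks. -/
structure IsTwoDesign {P B : Type*} [Fintype P] [DecidableEq P] [Fintype B]
    (D : B → Finset P) (v k l : ℕ) : Prop where
  card_points : Fintype.card P = v
  card_block : ∀ i : B, (D i).card = k
  balanced : ∀ x y : P, x ≠ y →
    (Finset.univ.filter (fun i : B => x ∈ D i ∧ y ∈ D i)).card = l

/-- The numbers `a` such that some pair of distinct blocks have exactly `a` points in common. -/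
def intersectionNumbers {P B : Type*} [DecidableEq P] (D : B → Finset P) : Set ℕ :=
  {a | ∃ i j : B, i ≠ j ∧ (D i ∩ D j).card = a}

/-- A quasi-symmetric 2-design with intersection numbers `l₁ < l₂`: a 2-design with exactly
these two intersection numbers. -/
structure IsQuasiSymmetric {P B : Type*} [Fintype P] [DecidableEq P] [Fintype B]
    (D : B → Finset P) (l₁ l₂ : ℕ) : Prop where
  isTwoDesign : ∃ v k l : ℕ, IsTwoDesign D v k l
  lt : l₁ < l₂
  intersectionNumbers_eq : intersectionNumbers D = {l₁, l₂}

/-- The block graph (with respect to the larger intersection number `l₂`): the vertices are the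
blocks, and two distinct blocks are adjacent iff they have exactly `l₂` points in common. -/
def blockGraph {P B : Type*} [DecidableEq P] (D : B → Finset P) (l₂ : ℕ) : SimpleGraph B where
  Adj i j := i ≠ j ∧ (D i ∩ D j).card = l₂
  symm := ⟨fun i j h => ⟨h.1.symm, by rw [Finset.inter_comm]; exact h.2⟩⟩
  loopless := ⟨fun _ h => h.1 rfl⟩

/-- A strongly resolvable 2-design of defect `μ` with block graph `K_{m × n}` (the complete
multipartite graph with `m` parts of size `n`): a quasi-symmetric 2-design whose intersection
numbers differ by `μ` and whose block graph is isomorphic to `K_{m × n}`. -/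
def IsStronglyResolvable {P B : Type*} [Fintype P] [DecidableEq P] [Fintype B]
    (D : B → Finset P) (m n μ : ℕ) : Prop :=
  ∃ l₁ l₂ : ℕ, IsQuasiSymmetric D l₁ l₂ ∧ l₂ - l₁ = μ ∧
    Nonempty (blockGraph D l₂ ≃g SimpleGraph.completeEquipartiteGraph m n)

open Classical in
/-- The `p`-adic Hilbert symbol `(a, b)_p` of two (nonzero) rational numbers: it is `1` if
`a x² + b y² = z²` has a solution `(x, y, z) ≠ (0, 0, 0)` in `ℚ_p`, and `-1` otherwise. -/
noncomputable def padicHilbertSymbol (p : ℕ) [Fact p.Prime] (a b : ℚ) : ℤ :=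
  if ∃ x y z : ℚ_[p], (x, y, z) ≠ (0, 0, 0) ∧
    (a : ℚ_[p]) * x ^ 2 + (b : ℚ_[p]) * y ^ 2 = z ^ 2 then 1 else -1

/-! Let `N` be the incidence matrix, with the blocks sorted into `m` classes of size `n`. On
zero-sum vectors `N Nᵀ` is the scalar `r - l`, so a nonzero eigenvalue of `Nᵀ N` on such vectors
must be `r - l`. Testing differences of two blocks in a class, and of two classes, gives `k - l₁ = r
- l = nμ`; double counting then gives `v + m = mn + 1`. Splitting a vector into its class sums and
its deviation from the class means yields a rational isometry ⟨nμ⟩^{mn} ⊥ ⟨v⟩ ≅ ⟨1⟩^v ⊥ ⟨μ⟩^m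
(`ResolvableIncidence.diagEquiv`).

All assertions follow from this isometry. Comparing discriminants gives (a1)-(a3) and so the square
class of `v`. By Lagrange's theorem four copies of ⟨a⟩ are isometric to four copies of ⟨1⟩
(`DiagEquiv.four_squares`). Padding the multiplicities to multiples of 4 and applying Witt
cancellation therefore leaves forms of dimension at most four, determined by `m` and `n` modulo 4
(`DesignIsometry.fill`). Values of binary forms give (b1)-(b6). For (b7) what remains is 3⟨nμ⟩ ≅ ⟨1,
μ, n⟩; the left side is a multiple of x² + y² + z², which is isotropic over ℚ_p exactly for odd `p`.
-/

/-! ### Isometry of rational diagonal forms, Witt cancellation, Lagrange's theorem -/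

/-- The diagonal quadratic forms over `ℚ` with coefficients `w` and `w'` are isometric. -/
def DiagEquiv {ι κ : Type*} [Fintype ι] [Fintype κ] (w : ι → ℚ) (w' : κ → ℚ) : Prop :=
  ∃ e : (ι → ℚ) ≃ₗ[ℚ] (κ → ℚ), ∀ x, ∑ k, w' k * (e x k) ^ 2 = ∑ i, w i * x i ^ 2

namespace DiagEquiv

variable {ι κ τ ι' κ' : Type*} [Fintype ι] [Fintype κ] [Fintype τ] [Fintype ι'] [Fintype κ']
  {w : ι → ℚ} {w' : κ → ℚ} {w'' : τ → ℚ} {u : ι' → ℚ} {u' : κ' → ℚ}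

theorem symm (h : DiagEquiv w w') : DiagEquiv w' w := by
  obtain ⟨e, he⟩ := h
  exact ⟨e.symm, fun x => by rw [← he, e.apply_symm_apply]⟩

theorem trans (h : DiagEquiv w w') (h' : DiagEquiv w' w'') : DiagEquiv w w'' := by
  obtain ⟨e, he⟩ := h
  obtain ⟨e', he'⟩ := h'
  exact ⟨e.trans e', fun x => by rw [LinearEquiv.trans_apply, he', he]⟩

theorem card_eq (h : DiagEquiv w w') : Fintype.card ι = Fintype.card κ := by
  obtain ⟨e, -⟩ := h
  simpa using e.finrank_eq

theorem of_equiv (σ : ι ≃ κ) (h : ∀ i, w' (σ i) = w i) : DiagEquiv w w' := by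
  refine ⟨LinearEquiv.funCongrLeft ℚ ℚ σ.symm, fun x => ?_⟩
  rw [← σ.sum_comp]
  refine Finset.sum_congr rfl fun i _ => ?_
  simp [LinearEquiv.funCongrLeft_apply, LinearMap.funLeft_apply, h]

theorem of_map_eq (h : Finset.univ.val.map w = Finset.univ.val.map w') : DiagEquiv w w' := by
  classical
  have hc : ∀ a : ℚ, Nonempty ({i // w i = a} ≃ {k // w' k = a}) := fun a => by
    rw [← Fintype.card_eq, Fintype.card_subtype, Fintype.card_subtype]
    have := congrArg (Multiset.count a) h
    rw [Multiset.count_map, Multiset.count_map] at this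
    simpa only [Finset.card_def, Finset.filter_val, eq_comm] using this
  exact of_equiv (Equiv.ofFiberEquiv fun a => (hc a).some)
    (fun i => Equiv.ofFiberEquiv_map (fun a => (hc a).some) i)

theorem sumElim (h : DiagEquiv w w') (h' : DiagEquiv u u') :
    DiagEquiv (Sum.elim w u) (Sum.elim w' u') := by
  obtain ⟨e, he⟩ := h
  obtain ⟨e', he'⟩ := h'
  refine ⟨(LinearEquiv.sumArrowLequivProdArrow ι ι' ℚ ℚ).trans ((e.prodCongr e').trans
    (LinearEquiv.sumArrowLequivProdArrow κ κ' ℚ ℚ).symm), fun x => ?_⟩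
  rw [Fintype.sum_sum_type, Fintype.sum_sum_type]
  simp only [LinearEquiv.trans_apply, LinearEquiv.prodCongr_apply, Sum.elim_inl, Sum.elim_inr,
    LinearEquiv.sumArrowLequivProdArrow_symm_apply_inl,
    LinearEquiv.sumArrowLequivProdArrow_symm_apply_inr, he, he']
  rfl

/-- A positive definite form has no nonzero vector of value 0, so a map preserving it is injective,
hence bijective between equal dimensions. -/
theorem of_linearMap (hw : ∀ i, 0 < w i) (hcard : Fintype.card ι = Fintype.card κ)
    (f : (ι → ℚ) →ₗ[ℚ] (κ → ℚ)) (hf : ∀ x, ∑ k, w' k * (f x k) ^ 2 = ∑ i, w i * x i ^ 2) :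
    DiagEquiv w w' := by
  have hinj : Function.Injective f := by
    rw [injective_iff_map_eq_zero]
    intro x hx
    have h := hf x
    simp only [hx, Pi.zero_apply, ne_eq, OfNat.ofNat_ne_zero, not_false_eq_true, zero_pow,
      mul_zero, Finset.sum_const_zero] at h
    have h0 := (Finset.sum_eq_zero_iff_of_nonneg
      (fun i _ => mul_nonneg (hw i).le (sq_nonneg (x i)))).1 h.symm
    ext i
    simpa [(hw i).ne'] using h0 i (Finset.mem_univ i)
  exact ⟨f.linearEquivOfInjective hinj (by simpa using hcard), hf⟩

/-- Witt cancellation for positive definite diagonal forms. -/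
theorem option_cancel {a : ℚ} (hw : ∀ i, 0 < w i)
    (h : DiagEquiv (fun o : Option ι => o.elim a w) (fun o : Option κ => o.elim a w')) :
    DiagEquiv w w' := by
  have hcard : Fintype.card ι = Fintype.card κ := by simpa using h.card_eq
  obtain ⟨e, he⟩ := h
  let inc : (ι → ℚ) →ₗ[ℚ] (Option ι → ℚ) :=
    { toFun := fun y o => o.elim 0 y
      map_add' := fun x y => by ext o; cases o <;> simp
      map_smul' := fun c y => by ext o; cases o <;> simp }
  let b : Option ι → ℚ := fun o => o.elim 1 (fun _ => 0)
  -- The sign `s` makes `e(t·b + y) none = s·t` solvable for `t`, namely by `t = ℓ y`. On these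
  -- vectors the `none` terms are `a·t²` and `a·(s·t)²`, which cancel.
  obtain ⟨s, hs, hs1⟩ : ∃ s : ℚ, s ^ 2 = 1 ∧ s - e b none ≠ 0 := by
    by_cases h1 : e b none = 1
    · exact ⟨-1, by norm_num, by rw [h1]; norm_num⟩
    · exact ⟨1, by norm_num, sub_ne_zero.2 (Ne.symm h1)⟩
  let ℓ : (ι → ℚ) →ₗ[ℚ] ℚ :=
    (s - e b none)⁻¹ • ((LinearMap.proj none).comp (e.toLinearMap.comp inc))
  let g : (ι → ℚ) →ₗ[ℚ] (Option ι → ℚ) := inc + ℓ.smulRight b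
  refine of_linearMap hw hcard ((LinearMap.funLeft ℚ ℚ (some : κ → Option κ)).comp
    (e.toLinearMap.comp g)) fun y => ?_
  have hg0 : g y none = ℓ y := by simp [g, inc, b]
  have hg1 : ∀ i, g y (some i) = y i := by simp [g, inc, b]
  have hg : e (g y) none = s * ℓ y := by
    have h1 : e (g y) none = e (inc y) none + ℓ y * e b none := by
      simp [g, map_add, map_smul]
    have h2 : e (inc y) none = (s - e b none) * ℓ y := by
      simp only [ℓ, LinearMap.smul_apply, LinearMap.comp_apply, LinearMap.proj_apply, smul_eq_mul,
        LinearEquiv.coe_coe]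
      rw [mul_inv_cancel_left₀ hs1]
    rw [h1, h2]; ring
  have := he (g y)
  simp only [Fintype.sum_option, Option.elim, hg, hg0, hg1, mul_pow, hs, one_mul] at this
  simpa [LinearMap.funLeft_apply] using this

theorem dotProduct_eq {f : (ι → ℚ) →ₗ[ℚ] (κ → ℚ)}
    (hf : ∀ x, ∑ k, w' k * (f x k) ^ 2 = ∑ i, w i * x i ^ 2) (x y : ι → ℚ) :
    ∑ k, w' k * (f x k * f y k) = ∑ i, w i * (x i * y i) := by
  have h := hf (x + y)
  simp only [map_add, Pi.add_apply, add_sq, mul_add, Finset.sum_add_distrib, hf] at h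
  have h1 : ∑ k, w' k * (2 * f x k * f y k) = ∑ i, w i * (2 * x i * y i) := by linarith
  have h2 : 2 * ∑ k, w' k * (f x k * f y k) = 2 * ∑ i, w i * (x i * y i) := by
    rw [Finset.mul_sum, Finset.mul_sum]
    refine (Finset.sum_congr rfl fun _ _ => ?_).trans
      (h1.trans (Finset.sum_congr rfl fun _ _ => ?_)) <;> ring
  linarith

/-- In matrix form the isometry can be transported to any extension field; the left inverse `B`
keeps it injective there. -/
theorem exists_matrix [DecidableEq ι] [DecidableEq κ] (h : DiagEquiv w w') :
    ∃ (A : Matrix κ ι ℚ) (B : Matrix ι κ ℚ), B * A = 1 ∧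
      A.transpose * Matrix.diagonal w' * A = Matrix.diagonal w := by
  obtain ⟨e, he⟩ := h
  refine ⟨LinearMap.toMatrix' e.toLinearMap, LinearMap.toMatrix' e.symm.toLinearMap, ?_, ?_⟩
  · rw [← LinearMap.toMatrix'_comp]
    simp
  · ext i j
    have := dotProduct_eq (f := e.toLinearMap) he (Pi.single i 1) (Pi.single j 1)
    rw [Matrix.mul_apply]
    simp only [Matrix.mul_diagonal, Matrix.transpose_apply, LinearMap.toMatrix'_apply]
    rw [show (∑ i, w i * ((Pi.single _ 1 : ι → ℚ) i * (Pi.single j 1 : ι → ℚ) i)) =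
      Matrix.diagonal w i j from ?_] at this
    · rw [← this]
      exact Finset.sum_congr rfl fun k _ => by ring
    · rw [Finset.sum_eq_single i]
      · by_cases hij : i = j
        · subst hij; simp
        · simp [hij]
      · intro b _ hb
        simp [Pi.single_apply, hb]
      · simp

/-- Take determinants in `Aᵀ D' A = D`, after reindexing to make `A` square. -/
theorem exists_prod_eq (h : DiagEquiv w w') : ∃ c : ℚ, ∏ i, w i = c ^ 2 * ∏ k, w' k := by
  classical
  have σ : κ ≃ ι := (Fintype.card_eq.1 h.card_eq).some.symm
  have h' : DiagEquiv w (w' ∘ σ.symm) := h.trans (of_equiv σ (by simp))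
  obtain ⟨A, -, -, hA⟩ := h'.exists_matrix
  have := congrArg Matrix.det hA
  rw [Matrix.det_mul, Matrix.det_mul, Matrix.det_transpose, Matrix.det_diagonal,
    Matrix.det_diagonal] at this
  refine ⟨A.det, ?_⟩
  rw [← this, ← σ.symm.prod_comp w']
  simp only [Function.comp]
  ring

theorem sum_mul_sq_eq_dotProduct {K : Type*} [Field K] [CharZero K] [DecidableEq ι] (v : ι → ℚ)
    (z : ι → K) : ∑ i, (v i : K) * z i ^ 2 =
      z ⬝ᵥ (Matrix.diagonal (Rat.castHom K ∘ v)).mulVec z := by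
  simp only [dotProduct, Matrix.mulVec_diagonal, Function.comp, Rat.coe_castHom]
  exact Finset.sum_congr rfl fun _ _ => by ring

/-- Isometric rational diagonal forms are simultaneously isotropic over any extension field. -/
theorem exists_isotropic {K : Type*} [Field K] [CharZero K] (h : DiagEquiv w w')
    (hx : ∃ x : ι → K, x ≠ 0 ∧ ∑ i, (w i : K) * x i ^ 2 = 0) :
    ∃ y : κ → K, y ≠ 0 ∧ ∑ k, (w' k : K) * y k ^ 2 = 0 := by
  classical
  obtain ⟨A, B, hBA, hA⟩ := h.exists_matrix
  obtain ⟨x, hx0, hx⟩ := hx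
  let c : ℚ →+* K := Rat.castHom K
  have hBA' : B.map c * A.map c = 1 := by
    rw [← Matrix.map_mul, hBA, Matrix.map_one c c.map_zero c.map_one]
  have hA' : (A.map c).transpose * Matrix.diagonal (c ∘ w') * A.map c
      = Matrix.diagonal (c ∘ w) := by
    have := congrArg (fun M => M.map c) hA
    simp only [Matrix.map_mul, Matrix.diagonal_map c.map_zero] at this
    exact this
  refine ⟨(A.map c).mulVec x, fun h0 => hx0 ?_, ?_⟩
  · rw [← Matrix.one_mulVec x, ← hBA', ← Matrix.mulVec_mulVec, h0, Matrix.mulVec_zero]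
  · rw [sum_mul_sq_eq_dotProduct, ← hx, sum_mul_sq_eq_dotProduct, ← hA', ← Matrix.mulVec_mulVec, ← Matrix.mulVec_mulVec,
      Matrix.dotProduct_mulVec x, Matrix.vecMul_transpose]

theorem exists_value [DecidableEq ι] (h : DiagEquiv w w') (i : ι) :
    ∃ x : κ → ℚ, ∑ k, w' k * x k ^ 2 = w i := by
  obtain ⟨e, he⟩ := h
  refine ⟨e (Pi.single i 1), (he _).trans ?_⟩
  simp [Pi.single_apply]

/-- Left multiplication by a quaternion of norm `a` multiplies the sum of four squares by `a`. -/
theorem four_squares {a : ℕ} (ha : 0 < a) :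
    DiagEquiv (fun _ : Fin 4 => (a : ℚ)) (fun _ : Fin 4 => 1) := by
  obtain ⟨p, q, r, s, h⟩ := Nat.sum_four_squares a
  have h' : (p : ℚ) ^ 2 + q ^ 2 + r ^ 2 + s ^ 2 = a := by exact_mod_cast h
  refine of_linearMap (fun _ => by positivity) rfl (Matrix.mulVecLin
    !![(p : ℚ), -q, -r, -s; q, p, -s, r; r, s, p, -q; s, -r, q, p]) fun x => ?_
  rw [← h']
  simp [Fin.sum_univ_four, Matrix.mulVec, dotProduct]
  ring

end DiagEquiv

/-! ### Diagonal forms as multisets of coefficients -/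

/-- The diagonal quadratic forms over `ℚ` whose coefficients are the members of `s` and `t` are
isometric. -/
def DiagIsometric (s t : Multiset ℚ) : Prop :=
  DiagEquiv (fun i : Fin s.toList.length => s.toList.get i)
    (fun i : Fin t.toList.length => t.toList.get i)

theorem Multiset.map_univ_get_toList (s : Multiset ℚ) :
    Finset.univ.val.map (fun i : Fin s.toList.length => s.toList.get i) = s := by
  rw [Fin.univ_val_map, List.ofFn_get, Multiset.coe_toList]

/-- The order and the indexing of the coefficients are immaterial, so multiset arithmetic can do the
bookkeeping. -/
theorem diagIsometric_map_iff {ι κ : Type*} [Fintype ι] [Fintype κ] {w : ι → ℚ} {w' : κ → ℚ} :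
    DiagIsometric (Finset.univ.val.map w) (Finset.univ.val.map w') ↔ DiagEquiv w w' :=
  ⟨fun h => ((DiagEquiv.of_map_eq (Multiset.map_univ_get_toList _).symm).trans h).trans
    (DiagEquiv.of_map_eq (Multiset.map_univ_get_toList _)),
  fun h => ((DiagEquiv.of_map_eq (Multiset.map_univ_get_toList _)).trans h).trans
    (DiagEquiv.of_map_eq (Multiset.map_univ_get_toList _).symm)⟩

namespace DiagIsometric

open Multiset

variable {s t u s' t' : Multiset ℚ}

theorem refl (s : Multiset ℚ) : DiagIsometric s s := DiagEquiv.of_map_eq rfl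

theorem symm (h : DiagIsometric s t) : DiagIsometric t s := DiagEquiv.symm h

theorem trans (h : DiagIsometric s t) (h' : DiagIsometric t u) : DiagIsometric s u :=
  DiagEquiv.trans h h'

theorem map_univ_sumElim {ι κ : Type*} [Fintype ι] [Fintype κ] (w : ι → ℚ) (w' : κ → ℚ) :
    Finset.univ.val.map (Sum.elim w w') = Finset.univ.val.map w + Finset.univ.val.map w' := by
  rw [← Finset.univ_disjSum_univ, Finset.val_disjSum, Multiset.disjSum, Multiset.map_add,
    Multiset.map_map, Multiset.map_map]
  rfl

theorem add (h : DiagIsometric s t) (h' : DiagIsometric s' t') :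
    DiagIsometric (s + s') (t + t') := by
  have := diagIsometric_map_iff.2 (DiagEquiv.sumElim h h')
  rwa [map_univ_sumElim, map_univ_sumElim, map_univ_get_toList, map_univ_get_toList,
    map_univ_get_toList, map_univ_get_toList] at this

theorem map_univ_option {ι : Type*} [Fintype ι] (a : ℚ) (w : ι → ℚ) :
    Finset.univ.val.map (fun o : Option ι => o.elim a w) = a ::ₘ Finset.univ.val.map w := by
  rw [univ_option, Finset.insertNone]
  simp [Finset.map]
  rfl

theorem cons_cancel {a : ℚ} (hs : ∀ b ∈ s, 0 < b) (h : DiagIsometric (a ::ₘ s) (a ::ₘ t)) :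
    DiagIsometric s t := by
  refine DiagEquiv.option_cancel (a := a) (fun i => hs _ ?_) ?_
  · exact Multiset.mem_toList.1 (List.get_mem _ _)
  · rwa [← diagIsometric_map_iff, map_univ_option, map_univ_option, map_univ_get_toList,
      map_univ_get_toList]

theorem add_cancel (hu : ∀ b ∈ u, 0 < b) (hs : ∀ b ∈ s, 0 < b)
    (h : DiagIsometric (u + s) (u + t)) : DiagIsometric s t := by
  induction u using Multiset.induction with
  | empty => simpa using h
  | cons a u ih =>
    rw [Multiset.cons_add, Multiset.cons_add] at h
    refine ih (fun b hb => hu b (Multiset.mem_cons_of_mem hb)) (h.cons_cancel fun b hb => ?_)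
    rcases Multiset.mem_add.1 hb with hb | hb
    · exact hu b (Multiset.mem_cons_of_mem hb)
    · exact hs b hb

theorem exists_prod_eq (h : DiagIsometric s t) : ∃ c : ℚ, s.prod = c ^ 2 * t.prod := by
  obtain ⟨c, hc⟩ := DiagEquiv.exists_prod_eq h
  refine ⟨c, ?_⟩
  rwa [Finset.prod_eq_multiset_prod, Finset.prod_eq_multiset_prod, map_univ_get_toList,
    map_univ_get_toList] at hc

theorem diagEquiv_pair {a b c d : ℚ} (h : DiagIsometric {a, b} {c, d}) :
    DiagEquiv ![a, b] ![c, d] :=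
  diagIsometric_map_iff.1 h

theorem exists_value {a b c d : ℚ} (h : DiagIsometric {a, b} {c, d}) :
    ∃ x y : ℚ, c * x ^ 2 + d * y ^ 2 = a := by
  obtain ⟨x, hx⟩ := h.diagEquiv_pair.exists_value 0
  exact ⟨x 0, x 1, by simpa [Fin.sum_univ_two] using hx⟩

theorem singleton {a b c : ℚ} (ha : 0 < a) (hb : 0 < b) (h : a * b = c ^ 2) :
    DiagIsometric {a} {b} := by
  refine (diagIsometric_map_iff (w := fun _ : Unit => a) (w' := fun _ : Unit => b)).2 ?_
  refine DiagEquiv.of_linearMap (fun _ => ha) rfl ((c / b) • LinearMap.id) fun x => ?_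
  simp only [Finset.univ_unique, Finset.sum_singleton, LinearMap.smul_apply, LinearMap.id_apply,
    Pi.smul_apply, smul_eq_mul, mul_pow, div_pow, ← h]
  field_simp

theorem replicate_four_mul {a : ℕ} (ha : 0 < a) (k : ℕ) :
    DiagIsometric (replicate (4 * k) (a : ℚ)) (replicate (4 * k) 1) := by
  induction k with
  | zero => exact refl _
  | succ k ih =>
    rw [mul_add, replicate_add, replicate_add]
    exact ih.add (by simpa using diagIsometric_map_iff.2 (DiagEquiv.four_squares ha))

end DiagIsometric

/-! ### Padding multiplicities to multiples of four -/

namespace DiagIsometric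

open Multiset

/-- Add `p` copies of `a` and `q` copies of `b` to both sides: the `4k` copies of `a` on the left
and the `4l` copies of `b` on the right turn into ones. -/
theorem fill_four {v m M : ℕ} {a b : ℕ} {c d : ℚ} (ha : 0 < a) (hb : 0 < b) (p q k l : ℕ)
    (hp : m + p = 4 * k) (hq : M + q = 4 * l)
    (H : DiagIsometric (replicate v 1 + replicate m (a : ℚ)) (replicate M (b : ℚ) + {c}))
    (hcd : DiagIsometric {c} {d}) :
    DiagIsometric (replicate (v + 4 * k) 1 + replicate q (b : ℚ))
      (replicate (4 * l) 1 + replicate p (a : ℚ) + {d}) := by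
  have h1 := H.add (refl (replicate p (a : ℚ) + replicate q (b : ℚ)))
  have h2 : replicate v (1 : ℚ) + replicate m (a : ℚ) + (replicate p (a : ℚ) + replicate q (b : ℚ))
      = replicate v 1 + replicate (4 * k) (a : ℚ) + replicate q (b : ℚ) := by
    rw [← hp, replicate_add]; abel
  have h3 : replicate M (b : ℚ) + {c} + (replicate p (a : ℚ) + replicate q (b : ℚ))
      = replicate (4 * l) (b : ℚ) + replicate p (a : ℚ) + {c} := by
    rw [← hq, replicate_add]; abel
  rw [h2, h3] at h1
  have h4 := ((refl (replicate v 1)).add (replicate_four_mul ha k)).add (refl (replicate q (b : ℚ)))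
  have h5 := ((replicate_four_mul hb l).add (refl (replicate p (a : ℚ)))).add hcd
  rw [← replicate_add] at h4
  exact (h4.symm.trans h1).trans h5

/-- `fill_four` with the surplus of coefficients `1` cancelled. -/
theorem fill_four_cancel {v m M : ℕ} {a b : ℕ} {c d : ℚ} (ha : 0 < a) (hb : 0 < b)
    (hm : 0 < m) (hv : v + m = M + 1)
    (H : DiagIsometric (replicate v 1 + replicate m (a : ℚ)) (replicate M (b : ℚ) + {c}))
    (hcd : DiagIsometric {c} {d}) (p q e₁ e₂ : ℕ) (hp : (m + p) % 4 = 0) (hq : (M + q) % 4 = 0)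
    (he : e₁ + q = e₂ + p + 1) (he₁ : e₁ ≤ 4) :
    DiagIsometric (replicate e₁ 1 + replicate q (b : ℚ))
      (replicate e₂ 1 + replicate p (a : ℚ) + {d}) := by
  obtain ⟨k, hk⟩ := Nat.dvd_of_mod_eq_zero hp
  obtain ⟨l, hl⟩ := Nat.dvd_of_mod_eq_zero hq
  -- `f` counts the ones common to both sides. It exists because `0 < m` forces `4 ≤ 4 * k`, while
  -- `e₁ ≤ 4`.
  obtain ⟨f, hf⟩ : ∃ f, v + 4 * k = f + e₁ := ⟨v + 4 * k - e₁, by omega⟩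
  have hf' : 4 * l = f + e₂ := by omega
  have h := fill_four ha hb p q k l hk hl H hcd
  rw [hf, hf', replicate_add, replicate_add, add_assoc, add_assoc, add_assoc] at h
  rw [add_assoc]
  have hb' : (0 : ℚ) < b := by exact_mod_cast hb
  refine h.add_cancel (fun x hx => ?_) (fun x hx => ?_)
  · rw [eq_of_mem_replicate hx]; exact one_pos
  · rcases Multiset.mem_add.1 hx with hx | hx <;> rw [eq_of_mem_replicate hx]
    exacts [one_pos, hb']

theorem cancel {s t s' t' u : Multiset ℚ} (h : DiagIsometric s t) (hpos : ∀ x ∈ s, 0 < x)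
    (hs : s = u + s') (ht : t = u + t') : DiagIsometric s' t' := by
  subst hs ht
  exact h.add_cancel (fun x hx => hpos x (Multiset.mem_add.2 (Or.inl hx)))
    (fun x hx => hpos x (Multiset.mem_add.2 (Or.inr hx)))

end DiagIsometric

/-! ### From rational to integral solutions -/

/-- A square factor does not change the parity of the valuations at primes congruent to 3 modulo 4.
-/
theorem Nat.eq_sq_add_sq_of_mul_sq {n c : ℕ} (hc : c ≠ 0) {a b : ℕ} (h : n * c ^ 2 = a ^ 2 + b ^ 2) :
    ∃ x y : ℕ, n = x ^ 2 + y ^ 2 := by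
  rcases n.eq_zero_or_pos with rfl | hn
  · exact ⟨0, 0, rfl⟩
  rw [Nat.eq_sq_add_sq_iff]
  intro q hq hq4
  have : Fact q.Prime := ⟨Nat.prime_of_mem_primeFactors hq⟩
  have := Nat.eq_sq_add_sq_iff.1 ⟨a, b, h⟩ q
    (Nat.primeFactors_mono (dvd_mul_right _ _) (by positivity) hq) hq4
  rw [padicValNat.mul hn.ne' (by positivity), padicValNat.pow] at this
  simpa [Nat.even_add] using this

theorem Nat.eq_sq_add_sq_of_rat {n : ℕ} {x y : ℚ} (h : (n : ℚ) = x ^ 2 + y ^ 2) :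
    ∃ a b : ℕ, n = a ^ 2 + b ^ 2 := by
  refine Nat.eq_sq_add_sq_of_mul_sq (c := x.den * y.den) (a := (x.num * y.den).natAbs)
    (b := (y.num * x.den).natAbs) (mul_ne_zero x.den_ne_zero y.den_ne_zero) ?_
  zify
  rw [sq_abs, sq_abs]
  have h' : (n : ℚ) * (x.den * y.den) ^ 2 = (x.num * y.den) ^ 2 + (y.num * x.den) ^ 2 := by
    rw [h, ← Rat.mul_den_eq_num x, ← Rat.mul_den_eq_num y]; ring
  exact_mod_cast h'

/-- A nontrivial rational zero of a ternary diagonal form gives a nontrivial integral one. -/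
theorem exists_int_zero_of_rat {a b : ℤ} {x y z : ℚ} (h0 : x ≠ 0 ∨ y ≠ 0 ∨ z ≠ 0)
    (h : (a : ℚ) * x ^ 2 + b * y ^ 2 = z ^ 2) :
    ∃ x y z : ℤ, (x, y, z) ≠ (0, 0, 0) ∧ a * x ^ 2 + b * y ^ 2 = z ^ 2 := by
  have hx := x.den_ne_zero
  have hy := y.den_ne_zero
  have hz := z.den_ne_zero
  refine ⟨x.num * (y.den * z.den), y.num * (x.den * z.den), z.num * (x.den * y.den), ?_, ?_⟩
  · simp only [ne_eq, Prod.mk.injEq, mul_eq_zero, Rat.num_eq_zero, Nat.cast_eq_zero, hx, hy, hz,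
      or_false]
    tauto
  · have h' : (a : ℚ) * (x.num * (y.den * z.den)) ^ 2 + b * (y.num * (x.den * z.den)) ^ 2
        = (z.num * (x.den * y.den)) ^ 2 := by
      rw [← Rat.mul_den_eq_num x, ← Rat.mul_den_eq_num y, ← Rat.mul_den_eq_num z]
      linear_combination (x.den * y.den * z.den : ℚ) ^ 2 * h
    exact_mod_cast h'

/-! ### Isotropy of x² + y² + z² over the p-adic numbers -/

/-- The form `x² + y² + z²` is anisotropic over `ℚ_2`. -/
theorem padic_two_sum_three_sq_ne_zero {x : Fin 3 → ℚ_[2]} (hx : x ≠ 0) :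
    ∑ i, x i ^ 2 ≠ 0 := by
  intro h
  -- Dividing by a coordinate of largest norm gives a zero in the 2-adic integers with one
  -- coordinate 1. Reduction modulo 4 excludes it, as squares there are 0 or 1.
  obtain ⟨j, -, hj⟩ := Finset.exists_max_image (Finset.univ : Finset (Fin 3)) (fun i => ‖x i‖)
    Finset.univ_nonempty
  have hj0 : x j ≠ 0 := by
    intro h0
    refine hx (funext fun i => ?_)
    have := hj i (Finset.mem_univ i)
    rwa [h0, norm_zero, norm_le_zero_iff] at this
  have hle : ∀ i, ‖x i / x j‖ ≤ 1 := fun i => by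
    rw [norm_div]
    exact div_le_one_of_le₀ (hj i (Finset.mem_univ i)) (norm_nonneg _)
  obtain ⟨y, hyx⟩ : ∃ y : Fin 3 → ℤ_[2], ∀ i, (y i : ℚ_[2]) = x i / x j :=
    ⟨fun i => ⟨x i / x j, hle i⟩, fun i => rfl⟩
  have hyj : y j = 1 := Subtype.ext ((hyx j).trans (div_self hj0))
  have hy : ∑ i, y i ^ 2 = 0 := by
    apply Subtype.ext
    rw [Fin.sum_univ_three] at h ⊢
    push_cast
    rw [hyx, hyx, hyx, div_pow, div_pow, div_pow, ← add_div, ← add_div, h, zero_div]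
  let z : Fin 3 → ZMod (2 ^ 2) := fun i => PadicInt.toZModPow 2 (y i)
  have hz : ∑ i, z i ^ 2 = 0 := by
    simp only [z, ← map_pow, ← map_sum, hy, map_zero]
  have hzj : z j = 1 := by simp only [z, hyj, map_one]
  have key : ∀ a b : ZMod (2 ^ 2), 1 + a ^ 2 + b ^ 2 ≠ 0 := by decide
  rw [Fin.sum_univ_three] at hz
  fin_cases j
  · exact key (z 1) (z 2) (by rw [← hz, show z 0 = 1 from hzj]; ring)
  · exact key (z 0) (z 2) (by rw [← hz, show z 1 = 1 from hzj]; ring)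
  · exact key (z 0) (z 1) (by rw [← hz, show z 2 = 1 from hzj]; ring)

/-- The form `x² + y² + z²` is isotropic over `ℚ_p` for odd `p`. -/
theorem padic_exists_sum_three_sq_eq_zero {p : ℕ} [Fact p.Prime] (hp : p ≠ 2) :
    ∃ x : Fin 3 → ℚ_[p], x ≠ 0 ∧ ∑ i, x i ^ 2 = 0 := by
  -- `a ≠ 0` is needed for Hensel: the derivative `2a` of X² + b² + 1 at `a` must be a unit. If `a =
  -- 0`, swap the two; both cannot vanish.
  obtain ⟨a, b, hab, ha⟩ : ∃ a b : ZMod p, a ^ 2 + b ^ 2 = -1 ∧ a ≠ 0 := by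
    obtain ⟨a, b, hab⟩ := ZMod.sq_add_sq p (-1)
    by_cases ha : a = 0
    · refine ⟨b, a, by rw [← hab, add_comm], fun hb => ?_⟩
      rw [ha, hb] at hab
      simp at hab
    · exact ⟨a, b, hab, ha⟩
  obtain ⟨α, rfl⟩ := ZMod.ringHom_surjective (PadicInt.toZMod (p := p)) a
  obtain ⟨β, rfl⟩ := ZMod.ringHom_surjective (PadicInt.toZMod (p := p)) b
  have hunit : ∀ u : ℤ_[p], PadicInt.toZMod u ≠ 0 → ‖u‖ = 1 := fun u hu => by
    by_contra h
    refine hu ?_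
    rw [← RingHom.mem_ker, PadicInt.ker_toZMod, IsLocalRing.mem_maximalIdeal,
      PadicInt.mem_nonunits]
    exact lt_of_le_of_ne u.norm_le_one h
  have h2 : (2 : ZMod p) ≠ 0 := by
    intro h
    have : p ∣ 2 := (ZMod.natCast_eq_zero_iff 2 p).1 (by exact_mod_cast h)
    exact hp ((Nat.prime_dvd_prime_iff_eq Fact.out Nat.prime_two).1 this)
  let F : Polynomial ℤ_[p] := Polynomial.X ^ 2 + Polynomial.C (β ^ 2 + 1)
  have hd : ‖F.derivative.aeval α‖ = 1 := by
    refine hunit _ ?_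
    simp only [F, Polynomial.derivative_add, Polynomial.derivative_C, add_zero,
      Polynomial.derivative_X_pow]
    simpa [map_ofNat] using ⟨h2, ha⟩
  have hF : ‖F.aeval α‖ < 1 := by
    rw [← PadicInt.mem_nonunits, ← IsLocalRing.mem_maximalIdeal, ← PadicInt.ker_toZMod,
      RingHom.mem_ker]
    simp only [F, map_add, map_pow, Polynomial.aeval_X, Polynomial.aeval_C, map_one,
      Algebra.algebraMap_self, RingHom.id_apply]
    rw [← add_assoc, hab]; ring
  obtain ⟨γ, hγ, -⟩ := hensels_lemma (F := F) (a := α) (by rw [hd]; simpa using hF)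
  refine ⟨![γ, β, 1], fun h => one_ne_zero (congrFun h 2), ?_⟩
  have h : γ ^ 2 + (β ^ 2 + 1) = 0 := by simpa [F] using hγ
  have h' : (γ : ℚ_[p]) ^ 2 + ((β : ℚ_[p]) ^ 2 + 1) = 0 := by exact_mod_cast congrArg Subtype.val h
  simpa [Fin.sum_univ_three, add_assoc] using h'

/-! ### Arithmetic consequences of the design isometry -/

/-- The isometry between rational diagonal forms that a strongly resolvable design provides. -/
structure DesignIsometry (m n μ v : ℕ) : Prop where
  two_le_left : 2 ≤ m
  two_le_right : 2 ≤ n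
  pos : 0 < μ
  add_eq : v + m = m * n + 1
  isometric : DiagIsometric (Multiset.replicate v 1 + Multiset.replicate m (μ : ℚ))
    (Multiset.replicate (m * n) ((n * μ : ℕ) : ℚ) + {(v : ℚ)})

namespace DesignIsometry

open Multiset

variable {m n μ v : ℕ} (h : DesignIsometry m n μ v)
include h

theorem v_pos : 0 < v := by
  have := h.add_eq
  have := Nat.mul_le_mul_left m (one_le_two.trans h.two_le_right)
  omega

/-- This compares discriminants; the parities of `m` and `mn` decide which of `μ`, `nμ` remain
beside `v` modulo squares. -/
theorem exists_pow_eq : ∃ c : ℚ, c ≠ 0 ∧ (μ : ℚ) ^ m = c ^ 2 * ((n * μ : ℚ) ^ (m * n) * v) := by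
  obtain ⟨c, hc⟩ := h.isometric.exists_prod_eq
  simp only [prod_add, prod_replicate, one_pow, one_mul, prod_singleton, Nat.cast_mul] at hc
  refine ⟨c, ?_, hc⟩
  rintro rfl
  have : (0 : ℚ) < (μ : ℚ) ^ m := pow_pos (by exact_mod_cast h.pos) _
  rw [hc] at this
  simp at this

theorem isSquare_of_even (hm : Even m) : IsSquare v := by
  obtain ⟨c, hc, H⟩ := h.exists_pow_eq
  obtain ⟨k, rfl⟩ := hm
  have hμ : (μ : ℚ) ≠ 0 := by exact_mod_cast h.pos.ne'
  have hn : (n : ℚ) ≠ 0 := by have := h.two_le_right; norm_cast; omega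
  rw [← Rat.isSquare_natCast_iff]
  refine ⟨μ ^ k / (c * (n * μ) ^ (k * n)), ?_⟩
  have : (v : ℚ) = (μ : ℚ) ^ (k + k) / (c ^ 2 * (n * μ : ℚ) ^ ((k + k) * n)) := by
    rw [H]; field_simp
  rw [this, add_mul, pow_add, pow_add]
  field_simp

theorem isSquare_of_odd_of_even (hm : Odd m) (hn : Even n) : IsSquare (v * μ) := by
  obtain ⟨c, hc, H⟩ := h.exists_pow_eq
  obtain ⟨k, rfl⟩ := hm
  obtain ⟨l, rfl⟩ := hn
  have hμ : (μ : ℚ) ≠ 0 := by exact_mod_cast h.pos.ne'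
  have hn : ((l + l : ℕ) : ℚ) ≠ 0 := by have := h.two_le_right; norm_cast; omega
  rw [← Rat.isSquare_natCast_iff]
  refine ⟨μ ^ (k + 1) / (c * ((l + l : ℕ) * μ) ^ ((2 * k + 1) * l)), ?_⟩
  have : (v : ℚ) = (μ : ℚ) ^ (2 * k + 1) /
      (c ^ 2 * ((l + l : ℕ) * μ : ℚ) ^ ((2 * k + 1) * (l + l))) := by
    rw [H]; field_simp
  push_cast at hn this ⊢
  rw [this, mul_add (2 * k + 1), pow_add _ ((2 * k + 1) * l)]
  field_simp
  ring

theorem isSquare_of_odd_of_odd (hm : Odd m) (hn : Odd n) : IsSquare (n * v) := by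
  obtain ⟨c, hc, H⟩ := h.exists_pow_eq
  obtain ⟨e, he⟩ := hm.mul hn
  obtain ⟨k, hk⟩ := hm
  have hμ : (μ : ℚ) ≠ 0 := by exact_mod_cast h.pos.ne'
  have hn : (n : ℚ) ≠ 0 := by have := h.two_le_right; norm_cast; omega
  rw [he, hk] at H
  rw [← Rat.isSquare_natCast_iff]
  refine ⟨μ ^ k / (c * (n * μ) ^ e), ?_⟩
  have : (v : ℚ) = (μ : ℚ) ^ (2 * k + 1) / (c ^ 2 * (n * μ : ℚ) ^ (2 * e + 1)) := by
    rw [H]; field_simp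
  push_cast
  rw [this]
  field_simp
  ring

/-- Here `p` and `q` complete `m` and `mn` to multiples of 4, `e₁` and `e₂` are the ones left after
cancellation, and `d` is a convenient representative of the square class of `v`. -/
theorem fill (p q e₁ e₂ : ℕ) {d : ℚ} (hd : DiagIsometric {(v : ℚ)} {d})
    (hp : (m + p) % 4 = 0) (hq : (m * n + q) % 4 = 0)
    (he : e₁ + q = e₂ + p + 1) (he₁ : e₁ ≤ 4) :
    DiagIsometric (replicate e₁ 1 + replicate q ((n * μ : ℕ) : ℚ))
      (replicate e₂ 1 + replicate p (μ : ℚ) + {d}) :=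
  DiagIsometric.fill_four_cancel h.pos
    (Nat.mul_pos (by have := h.two_le_right; omega) h.pos)
    (by have := h.two_le_left; omega) h.add_eq h.isometric hd p q e₁ e₂ hp hq he he₁

theorem isometric_right_of_odd (hm : Odd m) (hn : Odd n) : DiagIsometric {(v : ℚ)} {(n : ℚ)} := by
  obtain ⟨c, hc⟩ := h.isSquare_of_odd_of_odd hm hn
  refine DiagIsometric.singleton (c := c) (by exact_mod_cast h.v_pos)
    (by have := h.two_le_right; norm_cast; omega) ?_
  rw [mul_comm, sq]; exact_mod_cast hc

theorem isometric_defect (hm : Odd m) (hn : Even n) : DiagIsometric {(v : ℚ)} {(μ : ℚ)} := by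
  obtain ⟨c, hc⟩ := h.isSquare_of_odd_of_even hm hn
  refine DiagIsometric.singleton (c := c) (by exact_mod_cast h.v_pos)
    (by exact_mod_cast h.pos) ?_
  rw [sq]; exact_mod_cast hc

/-- If `n μ (x² + y²) = μ` then `n` is a sum of two squares. -/
theorem two_squares_of_isometric
    (H : DiagIsometric {((n * μ : ℕ) : ℚ), ((n * μ : ℕ) : ℚ)} {(μ : ℚ), (μ : ℚ)}) :
    ∃ a b : ℕ, n = a ^ 2 + b ^ 2 := by
  obtain ⟨x, y, hxy⟩ := H.exists_value
  have hμ : (μ : ℚ) ≠ 0 := by exact_mod_cast h.pos.ne'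
  refine Nat.eq_sq_add_sq_of_rat (x := x) (y := y) (mul_right_cancel₀ hμ ?_)
  push_cast at hxy
  linear_combination -hxy

theorem two_squares_of_two_mod_four (hm : m % 4 = 2) : ∃ a b : ℕ, n = a ^ 2 + b ^ 2 := by
  have hmn := Nat.mul_mod m n 4
  have hme : Even m := Nat.even_iff.2 (by omega)
  obtain ⟨s, hs⟩ := h.isSquare_of_even hme
  have hs4 := Nat.mul_mod s s 4
  have hadd := h.add_eq
  have hn4 : n % 4 < 4 := Nat.mod_lt _ (by norm_num)
  have hs4' : s % 4 < 4 := Nat.mod_lt _ (by norm_num)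
  -- For even `n` the square `v = mn - m + 1` would be 3 modulo 4.
  have hq : (m * n) % 4 = 2 := by
    rw [hm] at hmn
    interval_cases n % 4 <;> interval_cases s % 4 <;> omega
  have hd : DiagIsometric {(v : ℚ)} {1} :=
    DiagIsometric.singleton (c := s) (by exact_mod_cast h.v_pos) one_pos (by rw [hs]; push_cast; ring)
  have H := h.fill 2 2 1 0 hd (by omega) (by omega) rfl (by norm_num)
  have hb : (0 : ℚ) < (n * μ : ℕ) := by
    have := h.pos; have := h.two_le_right; positivity
  refine h.two_squares_of_isometric (H.cancel (u := {1}) ?_ ?_ ?_)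
  · simp only [mem_add, mem_replicate]
    rintro x (⟨-, rfl⟩ | ⟨-, rfl⟩)
    exacts [one_pos, hb]
  · rfl
  · simp only [replicate_succ, replicate_zero, insert_eq_cons, ← singleton_add]; abel

theorem two_squares_of_three_of_two (hm : m % 4 = 3) (hn : n % 4 = 2) :
    ∃ a b : ℕ, n = a ^ 2 + b ^ 2 := by
  have hmn : (m * n) % 4 = 2 := by rw [Nat.mul_mod, hm, hn]
  exact h.two_squares_of_isometric (h.fill 1 2 0 0
    (h.isometric_defect (Nat.odd_iff.2 (by omega)) (Nat.even_iff.2 (by omega)))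
    (by omega) (by omega) rfl (by norm_num))

theorem two_squares_of_three_of_zero (hm : m % 4 = 3) (hn : n % 4 = 0) :
    ∃ a b : ℕ, v = a ^ 2 + b ^ 2 := by
  have hmn : (m * n) % 4 = 0 := by rw [Nat.mul_mod, hm, hn]
  have hmo : Odd m := Nat.odd_iff.2 (by omega)
  have hne : Even n := Nat.even_iff.2 (by omega)
  have H : DiagIsometric {1, 1} {(μ : ℚ), (μ : ℚ)} := h.fill 1 0 2 0
    (h.isometric_defect hmo hne) (by omega) (by omega) rfl (by norm_num)
  obtain ⟨x, y, hxy⟩ := H.symm.exists_value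
  obtain ⟨s, hs⟩ := h.isSquare_of_odd_of_even hmo hne
  have hs' : (v : ℚ) * μ = s * s := by exact_mod_cast hs
  have hμ : (μ : ℚ) ≠ 0 := by exact_mod_cast h.pos.ne'
  -- `μ = x² + y²`, and `v = (s/μ)² μ` because `vμ = s²`.
  refine Nat.eq_sq_add_sq_of_rat (x := s / μ * x) (y := s / μ * y) ?_
  field_simp
  linear_combination (μ : ℚ) * hs' - s ^ 2 * hxy

theorem two_squares_of_one_of_two (hm : m % 4 = 1) (hn : n % 4 = 2) :
    ∃ a b : ℕ, n * v = a ^ 2 + b ^ 2 := by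
  have hmn : (m * n) % 4 = 2 := by rw [Nat.mul_mod, hm, hn]
  have hmo : Odd m := Nat.odd_iff.2 (by omega)
  have hne : Even n := Nat.even_iff.2 (by omega)
  have H : DiagIsometric {1, 1, ((n * μ : ℕ) : ℚ), ((n * μ : ℕ) : ℚ)} (replicate (4 * 1) (μ : ℚ)) :=
    h.fill 3 2 2 0 (h.isometric_defect hmo hne) (by omega) (by omega) rfl (by norm_num)
  have hb : (0 : ℚ) < (n * μ : ℕ) := by
    have := h.pos; have := h.two_le_right; positivity
  have H' : DiagIsometric {((n * μ : ℕ) : ℚ), ((n * μ : ℕ) : ℚ)} {1, 1} :=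
    (H.trans (DiagIsometric.replicate_four_mul h.pos 1)).cancel (u := {1, 1})
      (by simp only [insert_eq_cons, mem_cons, mem_singleton]; rintro x (rfl | rfl | rfl | rfl) <;>
            first | exact one_pos | exact hb) rfl rfl
  obtain ⟨x, y, hxy⟩ := H'.exists_value
  obtain ⟨s, hs⟩ := h.isSquare_of_odd_of_even hmo hne
  have hs' : (v : ℚ) * μ = s * s := by exact_mod_cast hs
  have hμ : (μ : ℚ) ≠ 0 := by exact_mod_cast h.pos.ne'
  refine Nat.eq_sq_add_sq_of_rat (x := s / μ * x) (y := s / μ * y) ?_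
  push_cast at hxy ⊢
  field_simp
  linear_combination (n : ℚ) * μ * hs' - s ^ 2 * hxy

theorem exists_zero_of_odd_of_ne (hm : Odd m) (hn : Odd n) (hmn : m % 4 ≠ n % 4) :
    ∃ x y z : ℤ, (x, y, z) ≠ (0, 0, 0) ∧
      (μ : ℤ) * x ^ 2 + (-1) ^ ((n - 1) / 2) * (n : ℤ) * y ^ 2 = z ^ 2 := by
  have hd := h.isometric_right_of_odd hm hn
  have hm2 := Nat.odd_iff.1 hm
  have hn2 := Nat.odd_iff.1 hn
  rcases (by omega : m % 4 = 1 ∧ n % 4 = 3 ∨ m % 4 = 3 ∧ n % 4 = 1) with ⟨hm, hn⟩ | ⟨hm, hn⟩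
  · have hmn : (m * n) % 4 = 3 := by rw [Nat.mul_mod, hm, hn]
    -- The extra ⟨μ⟩ completes 3⟨μ⟩ on the right to 4⟨μ⟩ ≅ 4⟨1⟩; what survives is ⟨nμ, μ⟩ ≅ ⟨1, n⟩,
    -- so `μ = x² + n y²`.
    have H := (h.fill 3 1 3 0 hd (by omega) (by omega) rfl (by norm_num)).add
      (DiagIsometric.refl {(μ : ℚ)})
    have hb : (0 : ℚ) < (n * μ : ℕ) := by
      have := h.pos; have := h.two_le_right; positivity
    have ha : (0 : ℚ) < μ := by exact_mod_cast h.pos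
    have H₁ : DiagIsometric (replicate 3 1 + {((n * μ : ℕ) : ℚ), (μ : ℚ)})
        (replicate (4 * 1) (μ : ℚ) + {(n : ℚ)}) := by
      convert H using 1 <;>
      · simp only [replicate_succ, replicate_zero, insert_eq_cons, ← singleton_add]; abel
    have H₂ : DiagIsometric {((n * μ : ℕ) : ℚ), (μ : ℚ)} {1, (n : ℚ)} :=
      (H₁.trans ((DiagIsometric.replicate_four_mul h.pos 1).add (DiagIsometric.refl _))).cancel
        (u := replicate 3 1)
        (by
          simp only [mem_add, mem_replicate, insert_eq_cons, mem_cons, mem_singleton]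
          rintro x (⟨-, rfl⟩ | rfl | rfl)
          exacts [one_pos, hb, ha]) rfl rfl
    obtain ⟨x, y, hxy⟩ := DiagIsometric.exists_value (a := (μ : ℚ)) (b := ((n * μ : ℕ) : ℚ))
      (c := 1) (d := (n : ℚ)) (by rw [Multiset.pair_comm]; exact H₂)
    have hodd : Odd ((n - 1) / 2) := Nat.odd_iff.2 (by omega)
    refine exists_int_zero_of_rat (x := 1) (y := y) (z := x) (Or.inl one_ne_zero) ?_
    rw [hodd.neg_one_pow]
    push_cast
    linear_combination -hxy
  · have hmn : (m * n) % 4 = 3 := by rw [Nat.mul_mod, hm, hn]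
    have H : DiagIsometric {1, ((n * μ : ℕ) : ℚ)} {(μ : ℚ), (n : ℚ)} :=
      h.fill 1 1 1 0 hd (by omega) (by omega) rfl (by norm_num)
    obtain ⟨x, y, hxy⟩ := H.exists_value
    have heven : Even ((n - 1) / 2) := Nat.even_iff.2 (by omega)
    refine exists_int_zero_of_rat (x := x) (y := y) (z := 1) (Or.inr (Or.inr one_ne_zero)) ?_
    rw [heven.neg_one_pow]
    push_cast
    linear_combination hxy

theorem exists_zero_of_one_of_one (hm : m % 4 = 1) (hn : n % 4 = 1) :
    ∃ x y z : ℤ, (x, y, z) ≠ (0, 0, 0) ∧ (n : ℤ) * x ^ 2 - (μ : ℤ) * y ^ 2 = z ^ 2 := by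
  have hd := h.isometric_right_of_odd (Nat.odd_iff.2 (by omega)) (Nat.odd_iff.2 (by omega))
  have hmn : (m * n) % 4 = 1 := by rw [Nat.mul_mod, hm, hn]
  have hb : 0 < n * μ := by have := h.pos; have := h.two_le_right; positivity
  have ha : (0 : ℚ) < μ := by exact_mod_cast h.pos
  -- Adding ⟨μ, nμ⟩ completes a block of four on each side. Cancelling leaves ⟨1, μ⟩ ≅ ⟨n, nμ⟩, so
  -- `n = x² + μ y²`.
  have H := (h.fill 3 3 1 0 hd (by omega) (by omega) rfl (by norm_num)).add
    (DiagIsometric.refl {(μ : ℚ), ((n * μ : ℕ) : ℚ)})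
  have H₁ : DiagIsometric (replicate (4 * 1) ((n * μ : ℕ) : ℚ) + {1, (μ : ℚ)})
      (replicate (4 * 1) (μ : ℚ) + {(n : ℚ), ((n * μ : ℕ) : ℚ)}) := by
    convert H using 1 <;>
    · simp only [replicate_succ, replicate_zero, insert_eq_cons, ← singleton_add]; abel
  have H₂ : DiagIsometric {1, (μ : ℚ)} {(n : ℚ), ((n * μ : ℕ) : ℚ)} :=
    ((((DiagIsometric.replicate_four_mul hb 1).symm.add (DiagIsometric.refl _)).trans H₁).trans
      ((DiagIsometric.replicate_four_mul h.pos 1).add (DiagIsometric.refl _))).cancel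
      (u := replicate (4 * 1) 1)
      (by
        simp only [mem_add, mem_replicate, insert_eq_cons, mem_cons, mem_singleton]
        rintro x (⟨-, rfl⟩ | rfl | rfl)
        exacts [one_pos, one_pos, ha]) rfl rfl
  obtain ⟨x, y, hxy⟩ := H₂.symm.exists_value
  obtain ⟨x, y, z, h0, hz⟩ := exists_int_zero_of_rat (a := n) (b := -μ) (x := 1) (y := y) (z := x)
    (Or.inl one_ne_zero) (by push_cast; linear_combination -hxy)
  exact ⟨x, y, z, h0, by linear_combination hz⟩

/-- The symbol is 1 exactly when ⟨1, μ, n⟩ ≅ 3⟨nμ⟩ is isotropic over ℚ_p, that is, when x² + y² + z²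
is. -/
theorem padicHilbertSymbol_eq (hm : m % 4 = 3) (hn : n % 4 = 3) (p : ℕ) [Fact p.Prime] :
    padicHilbertSymbol p (-(μ : ℚ)) (-(n : ℚ)) = if p = 2 then -1 else 1 := by
  have hd := h.isometric_right_of_odd (Nat.odd_iff.2 (by omega)) (Nat.odd_iff.2 (by omega))
  have hmn : (m * n) % 4 = 1 := by rw [Nat.mul_mod, hm, hn]
  have hb : ((n * μ : ℕ) : ℚ_[p]) ≠ 0 := by
    have := h.pos; have := h.two_le_right; rw [Nat.cast_ne_zero]; positivity
  have H : DiagEquiv ![((n * μ : ℕ) : ℚ), ((n * μ : ℕ) : ℚ), ((n * μ : ℕ) : ℚ)]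
      ![1, (μ : ℚ), (n : ℚ)] :=
    diagIsometric_map_iff.1 (h.fill 1 3 0 1 hd (by omega) (by omega) rfl (by norm_num))
  unfold padicHilbertSymbol
  by_cases hp : p = 2
  · subst hp
    rw [if_neg, if_pos rfl]
    rintro ⟨x, y, z, h0, hxyz⟩
    obtain ⟨w, hw, hw'⟩ := H.symm.exists_isotropic (K := ℚ_[2]) ⟨![z, x, y], fun h => h0 (by
      have h1 := congrFun h 0
      have h2 := congrFun h 1
      have h3 := congrFun h 2
      simp_all), by
      simp [Fin.sum_univ_three]; push_cast at hxyz; linear_combination -hxyz⟩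
    refine padic_two_sum_three_sq_ne_zero hw ?_
    rw [Fin.sum_univ_three] at hw' ⊢
    refine (mul_eq_zero.1 ?_).resolve_left hb
    simp only [Matrix.cons_val, Rat.cast_natCast] at hw'
    linear_combination hw'
  · rw [if_pos, if_neg hp]
    obtain ⟨w, hw, hw'⟩ := padic_exists_sum_three_sq_eq_zero hp
    obtain ⟨y, hy, hy'⟩ := H.exists_isotropic (K := ℚ_[p]) ⟨w, hw, by
      rw [Fin.sum_univ_three] at hw' ⊢
      simp
      linear_combination (n * μ : ℚ_[p]) * hw'⟩
    refine ⟨y 1, y 2, y 0, fun h => hy ?_, ?_⟩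
    · simp only [Prod.mk.injEq] at h
      ext i
      fin_cases i <;> simp [h]
    · simp [Fin.sum_univ_three] at hy'
      push_cast
      linear_combination -hy'

end DesignIsometry

/-! ### Gram matrices, parameters and the isometry -/

/-- A rational incidence matrix `N` with block classes of size `n` indexed by `Fin m`: the Gram
matrices of rows and of columns of a strongly resolvable design. -/
structure ResolvableIncidence {P : Type*} [Fintype P] {m n : ℕ}
    (N : P → Fin m × Fin n → ℚ) (k r l l₁ μ : ℚ) : Prop where
  col_sum : ∀ i, ∑ x, N x i = k
  row_sum : ∀ x, ∑ i, N x i = r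
  col_mul_self : ∀ i, ∑ x, N x i * N x i = k
  col_mul_same : ∀ i j, i ≠ j → i.1 = j.1 → ∑ x, N x i * N x j = l₁
  col_mul_ne : ∀ i j, i.1 ≠ j.1 → ∑ x, N x i * N x j = l₁ + μ
  row_mul_self : ∀ x, ∑ i, N x i * N x i = r
  row_mul : ∀ x y, x ≠ y → ∑ i, N x i * N y i = l

namespace ResolvableIncidence

variable {P : Type*} [Fintype P] {m n : ℕ} {N : P → Fin m × Fin n → ℚ} {k r l l₁ μ : ℚ}
  (h : ResolvableIncidence N k r l l₁ μ)
include h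

theorem col_gram (i j : Fin m × Fin n) : ∑ x, N x i * N x j =
    (k - l₁) * (if i = j then 1 else 0) - μ * (if i.1 = j.1 then 1 else 0) + (l₁ + μ) := by
  by_cases hij : i = j
  · subst hij
    rw [h.col_mul_self]; simp
  · by_cases hij' : i.1 = j.1
    · rw [h.col_mul_same i j hij hij', if_neg hij, if_pos hij']; ring
    · rw [h.col_mul_ne i j hij', if_neg hij, if_neg hij']; ring

theorem sum_col_mul (z : Fin m × Fin n → ℚ) (j : Fin m × Fin n) :
    ∑ x, N x j * ∑ i, N x i * z i =
      (k - l₁) * z j - μ * ∑ b, z (j.1, b) + (l₁ + μ) * ∑ i, z i := by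
  have h1 : ∑ x, N x j * ∑ i, N x i * z i = ∑ i, (∑ x, N x j * N x i) * z i := by
    simp only [Finset.mul_sum, Finset.sum_mul]
    rw [Finset.sum_comm]
    exact Finset.sum_congr rfl fun _ _ => Finset.sum_congr rfl fun _ _ => by ring
  have h2 : ∑ i : Fin m × Fin n, (if j.1 = i.1 then 1 else 0) * z i = ∑ b, z (j.1, b) := by
    rw [Fintype.sum_prod_type, Finset.sum_eq_single j.1]
    · simp
    · intro c _ hc; simp [hc.symm]
    · simp
  simp only [h1, h.col_gram, add_mul, sub_mul, Finset.sum_add_distrib, Finset.sum_sub_distrib,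
    mul_assoc, ← Finset.mul_sum, h2]
  simp

theorem sum_sum_mul (z : Fin m × Fin n → ℚ) : ∑ x, ∑ i, N x i * z i = k * ∑ i, z i := by
  rw [Finset.sum_comm, Finset.mul_sum]
  exact Finset.sum_congr rfl fun i _ => by rw [← Finset.sum_mul, h.col_sum]

theorem sum_row_mul (y : P) (u : P → ℚ) :
    ∑ x, (∑ j, N y j * N x j) * u x = (r - l) * u y + l * ∑ x, u x := by
  classical
  have : ∀ x, (∑ j, N y j * N x j) * u x = (r - l) * (if y = x then u x else 0) + l * u x := by
    intro x
    by_cases hxy : y = x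
    · subst hxy; rw [h.row_mul_self, if_pos rfl]; ring
    · rw [h.row_mul y x hxy, if_neg hxy]; ring
  simp [this, Finset.sum_add_distrib, ← Finset.mul_sum]

/-- If `Nᵀ N z = c z`, then `N z` has coordinate sum zero (constant column sums), so `N Nᵀ`
multiplies it by both `c` and `r - l`. Either these agree or `N z = 0`, and then `c = 0`. -/
theorem eigenvalue {z : Fin m × Fin n → ℚ} {c : ℚ} (hz : ∑ i, z i = 0)
    (hc : ∀ j, (k - l₁) * z j - μ * ∑ b, z (j.1, b) = c * z j) (hz0 : ∃ i, z i ≠ 0) :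
    c = r - l ∨ c = 0 := by
  have hN : ∀ j, ∑ x, N x j * ∑ i, N x i * z i = c * z j := fun j => by
    rw [h.sum_col_mul, hz, mul_zero, add_zero, hc]
  by_contra! hne
  have hNz : ∀ y, ∑ i, N y i * z i = 0 := by
    intro y
    have h1 := h.sum_row_mul y (fun x => ∑ i, N x i * z i)
    rw [h.sum_sum_mul, hz] at h1
    have h2 : ∀ g : P → ℚ,
        ∑ x, (∑ j, N y j * N x j) * g x = ∑ j, N y j * ∑ x, N x j * g x := fun g => by
      simp only [Finset.sum_mul, Finset.mul_sum]
      rw [Finset.sum_comm]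
      exact Finset.sum_congr rfl fun _ _ => Finset.sum_congr rfl fun _ _ => by ring
    rw [h2] at h1
    simp only [hN] at h1
    have h3 : ∑ j, N y j * (c * z j) = c * ∑ i, N y i * z i := by
      rw [Finset.mul_sum]; exact Finset.sum_congr rfl fun _ _ => by ring
    have h4 : (c - (r - l)) * ∑ i, N y i * z i = 0 := by rw [h3] at h1; linear_combination h1
    exact (mul_eq_zero.1 h4).resolve_left (sub_ne_zero.2 hne.1)
  obtain ⟨i, hi⟩ := hz0
  have := hN i
  simp only [hNz, mul_zero, Finset.sum_const_zero] at this
  exact (mul_ne_zero hne.2 hi) this.symm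

theorem sub_eq (hm : 2 ≤ m) (hn : 2 ≤ n) (hμ : 0 < μ) (hk : l₁ + μ < k) :
    k - l₁ = n * μ ∧ r - l = n * μ := by
  have hn0 : (0 : ℚ) < n := by norm_cast; omega
  have h1 : k - l₁ = r - l := by
    let a : Fin m × Fin n := (⟨0, by omega⟩, ⟨0, by omega⟩)
    let b : Fin m × Fin n := (⟨0, by omega⟩, ⟨1, by omega⟩)
    have hab : a ≠ b := by simp [a, b]
    let z : Fin m × Fin n → ℚ := Pi.single a 1 - Pi.single b 1
    have hcls : ∀ c, ∑ d, z (c, d) = 0 := by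
      intro c
      simp only [z, Pi.sub_apply, Finset.sum_sub_distrib, Pi.single_apply, a, b, Prod.mk.injEq]
      by_cases hc : c = ⟨0, by omega⟩ <;> simp [hc]
    refine (h.eigenvalue (z := z) (c := k - l₁) ?_ ?_ ⟨a, ?_⟩).resolve_right (by linarith)
    · simp [Fintype.sum_prod_type, hcls]
    · intro j; rw [hcls]; ring
    · simp [z, hab]
  have h2 : k - l₁ - n * μ = 0 := by
    -- The difference of two class indicators has eigenvalue `k - l₁ - nμ`. It is not `r - l = k -
    -- l₁` since `nμ > 0`, so it vanishes.
    let z : Fin m × Fin n → ℚ := fun i =>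
      (Pi.single (⟨0, by omega⟩ : Fin m) 1 - Pi.single ⟨1, by omega⟩ 1 : Fin m → ℚ) i.1
    refine (h.eigenvalue (z := z) (c := k - l₁ - n * μ) ?_ ?_
      ⟨(⟨0, by omega⟩, ⟨0, by omega⟩), ?_⟩).resolve_left ?_
    · simp [z, Fintype.sum_prod_type, ← Finset.mul_sum]
    · intro j
      simp only [z, Finset.sum_const, Finset.card_univ, Fintype.card_fin, nsmul_eq_mul]
      ring
    · simp [z]
    · rw [← h1]
      have := mul_pos hn0 hμ
      intro h; linarith
  exact ⟨by linarith, by linarith⟩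

theorem card_points_add (hm : 2 ≤ m) (hn : 2 ≤ n) (hμ : 0 < μ) (hk : l₁ + μ < k) :
    Fintype.card P + m = m * n + 1 := by
  obtain ⟨h1, h2⟩ := h.sub_eq hm hn hμ hk
  have hn0 : (0 : ℚ) < n := by norm_cast; omega
  let a : Fin m × Fin n := (⟨0, by omega⟩, ⟨0, by omega⟩)
  -- Without points, `k` and `l₁ + μ` would both be 0, against `hk`.
  have hP : ∃ _ : P, True := by
    by_contra! hP
    have : IsEmpty P := ⟨fun x => hP x⟩
    have h0 := h.col_sum a
    have h3 := h.col_mul_ne a (⟨1, by omega⟩, ⟨0, by omega⟩) (by simp [a])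
    rw [Finset.univ_eq_empty, Finset.sum_empty] at h0 h3
    linarith
  obtain ⟨y, -⟩ := hP
  have hvr : (m * n : ℚ) * k = Fintype.card P * r := by
    have h3 := h.sum_sum_mul (fun _ => 1)
    simp only [mul_one, h.row_sum] at h3
    simp at h3
    linarith
  have hkr : k * r = (l₁ + μ) * (m * n) := by
    have h3 := h.sum_col_mul (fun _ => 1) a
    simp only [mul_one, h.row_sum, ← Finset.sum_mul, h.col_sum] at h3
    simp at h3
    linear_combination h3 + h1
  have hrk : r * k = (r - l) + l * Fintype.card P := by
    have h3 := h.sum_row_mul y (fun _ => 1)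
    simp only [mul_one] at h3
    rw [Finset.sum_comm] at h3
    simp only [← Finset.mul_sum, h.col_sum, ← Finset.sum_mul, h.row_sum] at h3
    simpa using h3
  have : ((Fintype.card P : ℚ) + m - (m * n + 1)) * (n * μ) = 0 := by
    linear_combination (1 - (Fintype.card P : ℚ)) * h2 + m * n * h1 - hvr + hrk - hkr
  have := (mul_eq_zero.1 this).resolve_right (mul_pos hn0 hμ).ne'
  have h5 : (Fintype.card P : ℚ) + m = m * n + 1 := by linarith
  exact_mod_cast h5

/-- On vectors with zero class sums `N` multiplies the square norm by `nμ` and has image orthogonal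
to constants. Passing to deviations from class means loses `(1/n) ∑ Z_c²`; the coordinates `Z_c` of
weight `μ` restore exactly `nμ` times this, and the constant `t` contributes `v t²`. -/
theorem diagEquiv (hm : 2 ≤ m) (hn : 2 ≤ n) (hμ : 0 < μ) (hk : l₁ + μ < k) :
    DiagEquiv (Sum.elim (fun _ : Fin m × Fin n => (n * μ : ℚ)) (fun _ : Unit => (Fintype.card P : ℚ)))
      (Sum.elim (fun _ : P => (1 : ℚ)) (fun _ : Fin m => μ)) := by
  have hcard := h.card_points_add hm hn hμ hk
  obtain ⟨h1, h2⟩ := h.sub_eq hm hn hμ hk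
  have hn0 : (0 : ℚ) < n := by norm_cast; omega
  have hv : 0 < Fintype.card P := by
    have := Nat.mul_le_mul_left m (one_le_two.trans hn)
    omega
  let f : (Fin m × Fin n ⊕ Unit → ℚ) →ₗ[ℚ] (P ⊕ Fin m → ℚ) :=
    { toFun := fun z => Sum.elim
        (fun x => ∑ i, N x i * (z (.inl i) - (n : ℚ)⁻¹ * ∑ b, z (.inl (i.1, b))) + z (.inr ()))
        (fun c => ∑ b, z (.inl (c, b)))
      map_add' := fun z z' => by
        ext (x | c)
        · simp only [Sum.elim_inl, Pi.add_apply, Finset.sum_add_distrib, mul_add, mul_sub,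
            Finset.sum_sub_distrib]
          ring
        · simp [Finset.sum_add_distrib]
      map_smul' := fun a z => by
        ext (x | c)
        · simp only [Sum.elim_inl, Pi.smul_apply, smul_eq_mul, RingHom.id_apply, ← Finset.mul_sum,
            mul_add]
          rw [Finset.mul_sum]
          congr 1
          exact Finset.sum_congr rfl fun _ _ => by ring
        · simp [Finset.mul_sum] }
  refine DiagEquiv.of_linearMap ?_ ?_ f fun z => ?_
  · rintro (i | i)
    · exact mul_pos hn0 hμ
    · exact Nat.cast_pos.2 hv
  · simpa using hcard.symm
  set Z : Fin m → ℚ := fun c => ∑ b, z (.inl (c, b)) with hZ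
  set u : Fin m × Fin n → ℚ := fun i => z (.inl i) - (n : ℚ)⁻¹ * Z i.1 with hu
  set t : ℚ := z (.inr ())
  have hu0 : ∀ c, ∑ b, u (c, b) = 0 := fun c => by
    simp only [hu, Finset.sum_sub_distrib, Finset.sum_const, Finset.card_univ, Fintype.card_fin,
      nsmul_eq_mul, mul_inv_cancel_left₀ hn0.ne']
    exact sub_self _
  have hus : ∑ i, u i = 0 := by simp [Fintype.sum_prod_type, hu0]
  have hq : ∑ i, u i ^ 2 = ∑ i, z (.inl i) ^ 2 - (n : ℚ)⁻¹ * ∑ c, Z c ^ 2 := by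
    rw [Fintype.sum_prod_type, Fintype.sum_prod_type, Finset.mul_sum, ← Finset.sum_sub_distrib]
    refine Finset.sum_congr rfl fun c _ => ?_
    have h3 : ∀ b, u (c, b) ^ 2 = z (.inl (c, b)) ^ 2 - 2 * (n : ℚ)⁻¹ * Z c * z (.inl (c, b))
        + ((n : ℚ)⁻¹ * Z c) ^ 2 := fun b => by simp only [hu]; ring
    simp only [h3, Finset.sum_add_distrib, Finset.sum_sub_distrib, ← Finset.mul_sum,
      Finset.sum_const, Finset.card_univ, Fintype.card_fin, nsmul_eq_mul]
    rw [show ∑ b, z (.inl (c, b)) = Z c from rfl]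
    field_simp
    ring
  have hNu : ∑ x, (∑ i, N x i * u i) ^ 2 = n * μ * ∑ i, u i ^ 2 := by
    have h3 : ∀ g : P → ℚ, ∑ x, (∑ i, N x i * u i) * g x = ∑ j, u j * ∑ x, N x j * g x :=
      fun g => by
        simp only [Finset.sum_mul, Finset.mul_sum]
        rw [Finset.sum_comm]
        exact Finset.sum_congr rfl fun _ _ => Finset.sum_congr rfl fun _ _ => by ring
    simp only [sq]
    rw [h3, Finset.mul_sum]
    refine Finset.sum_congr rfl fun j _ => ?_
    rw [h.sum_col_mul, hu0, hus, h1]; ring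
  have hN0 : ∑ x, ∑ i, N x i * u i = 0 := by rw [h.sum_sum_mul, hus, mul_zero]
  have hf1 : ∀ x, f z (.inl x) = ∑ i, N x i * u i + t := fun x => rfl
  have hf2 : ∀ c, f z (.inr c) = Z c := fun c => rfl
  simp only [Fintype.sum_sum_type, Sum.elim_inl, Sum.elim_inr, hf1, hf2, one_mul, add_sq,
    Finset.sum_add_distrib, hNu, hq, ← Finset.mul_sum, ← Finset.sum_mul, hN0]
  simp only [Finset.univ_unique, Finset.sum_singleton, Finset.sum_const, Finset.card_univ,
    nsmul_eq_mul]
  change _ = _ + _ * t ^ 2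
  field_simp
  ring

end ResolvableIncidence

theorem ResolvableIncidence.designIsometry {P : Type*} [Fintype P] {m n μ : ℕ}
    {N : P → Fin m × Fin n → ℚ} {k r l l₁ : ℚ} (h : ResolvableIncidence N k r l l₁ (μ : ℚ))
    (hm : 2 ≤ m) (hn : 2 ≤ n) (hμ : 0 < μ) (hk : l₁ + μ < k) :
    DesignIsometry m n μ (m * n - m + 1) := by
  have hμ' : (0 : ℚ) < μ := by exact_mod_cast hμ
  have hcard := h.card_points_add hm hn hμ' hk
  have hv : m * n - m + 1 = Fintype.card P := by
    have := Nat.mul_le_mul_left m (one_le_two.trans hn)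
    omega
  rw [hv]
  refine ⟨hm, hn, hμ, hcard, ?_⟩
  have H := diagIsometric_map_iff.2 (h.diagEquiv hm hn hμ' hk).symm
  rw [DiagIsometric.map_univ_sumElim, DiagIsometric.map_univ_sumElim] at H
  simpa [Multiset.map_const'] using H

/-! ### From the design to its incidence matrix -/

theorem IsStronglyResolvable.designIsometry {P B : Type*} [Fintype P] [DecidableEq P] [Fintype B]
    {D : B → Finset P} {m n μ : ℕ} (hm : 2 ≤ m) (hn : 2 ≤ n) (hμ : 0 < μ)
    (hD : IsStronglyResolvable D m n μ) : DesignIsometry m n μ (m * n - m + 1) := by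
  obtain ⟨l₁, l₂, ⟨⟨v, k, l, ⟨hv, hk, hl⟩⟩, hlt, hint⟩, hsub, ⟨φ⟩⟩ := hD
  let E : Fin m × Fin n → Finset P := fun i => D (φ.symm i)
  have hEk : ∀ i, (E i).card = k := fun i => hk _
  have hne : ∀ i j : Fin m × Fin n, i.1 ≠ j.1 → (E i ∩ E j).card = l₂ := fun i j hij =>
    ((φ.symm.map_adj_iff (v := i) (w := j)).2 hij).2
  have hsame : ∀ i j : Fin m × Fin n, i ≠ j → i.1 = j.1 → (E i ∩ E j).card = l₁ := by
    intro i j hij hij'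
    have hij₂ : φ.symm i ≠ φ.symm j := fun h => hij (φ.symm.injective h)
    have hmem : (E i ∩ E j).card ∈ intersectionNumbers D := ⟨_, _, hij₂, rfl⟩
    rw [hint] at hmem
    refine hmem.resolve_right fun h => ?_
    exact (φ.symm.map_adj_iff (v := i) (w := j)).1 ⟨hij₂, h⟩ hij'
  let a : Fin m × Fin n := (⟨0, by omega⟩, ⟨0, by omega⟩)
  let b : Fin m × Fin n := (⟨0, by omega⟩, ⟨1, by omega⟩)
  let c : Fin m × Fin n := (⟨1, by omega⟩, ⟨0, by omega⟩)
  -- If `l₂ = k`, blocks of different classes coincide. Then `a` and `b`, in one class, both equal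
  -- block `c`, so `l₁ = k = l₂`, a contradiction.
  have hlk : l₂ < k := by
    refine lt_of_le_of_ne ?_ fun h => ?_
    · rw [← hne a c (by simp [a, c]), ← hEk a]
      exact Finset.card_le_card Finset.inter_subset_left
    · have hsub : ∀ i, i.1 ≠ c.1 → E i = E c := fun i hi => by
        have h1 := hne i c hi
        have h2 : E i ∩ E c = E i :=
          Finset.eq_of_subset_of_card_le Finset.inter_subset_left (by rw [h1, hEk, h])
        have h3 : E i ∩ E c = E c :=
          Finset.eq_of_subset_of_card_le Finset.inter_subset_right (by rw [h1, hEk, h])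
        exact h2.symm.trans h3
      have h1 := hsame a b (by simp [a, b]) rfl
      rw [hsub a (by simp [a, c]), hsub b (by simp [b, c]), Finset.inter_self, hEk] at h1
      omega
  let N : P → Fin m × Fin n → ℚ := fun x i => if x ∈ E i then 1 else 0
  have hNN : ∀ x y i j, N x i * N y j = if x ∈ E i ∧ y ∈ E j then 1 else 0 := by
    intro x y i j
    by_cases h1 : x ∈ E i <;> by_cases h2 : y ∈ E j <;> simp [N, h1, h2]
  have hself : ∀ x i, N x i * N x i = N x i := fun x i => by simp [N]
  have hcol : ∀ i, ∑ x, N x i = k := fun i => by simp [N, hEk]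
  have hcol₂ : ∀ i j, ∑ x, N x i * N x j = (E i ∩ E j).card := fun i j => by
    simp only [hNN, ← Finset.mem_inter, Finset.sum_boole, Finset.filter_univ_mem]
  have hrow : ∀ x y, x ≠ y → ∑ i, N x i * N y i = l := by
    intro x y hxy
    have h1 := φ.symm.toEquiv.sum_comp
      (fun i => if x ∈ D i ∧ y ∈ D i then (1 : ℚ) else 0)
    simp only [hNN]
    rw [← hl x y hxy, Finset.card_filter]
    push_cast
    exact h1
  have hk1 : (k : ℚ) - 1 ≠ 0 := by
    have : (1 : ℚ) < k := by norm_cast; omega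
    linarith
  -- Counting pairs of a point `y` and a block through `x` and `y` gives `r (k - 1) = l (v - 1)` for
  -- `y ≠ x`, so `r` does not depend on `x`.
  have hr : ∀ x, ∑ i, N x i = l * (v - 1) / (k - 1) := by
    intro x
    rw [eq_div_iff hk1]
    have h1 : ∑ y, ∑ i, N x i * N y i = k * ∑ i, N x i := by
      rw [Finset.sum_comm]
      simp only [← Finset.mul_sum, hcol, ← Finset.sum_mul]
      ring
    rw [← Finset.add_sum_erase _ _ (Finset.mem_univ x), Finset.sum_congr rfl
      (fun y hy => hrow x y (Finset.ne_of_mem_erase hy).symm), Finset.sum_const,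
      Finset.card_erase_of_mem (Finset.mem_univ x), Finset.card_univ, hv, nsmul_eq_mul,
      Nat.cast_sub (by rw [← hv]; exact Fintype.card_pos_iff.2 ⟨x⟩)] at h1
    simp only [hself] at h1
    push_cast at h1
    linear_combination -h1
  have hl₂ : (l₂ : ℚ) = l₁ + μ := by norm_cast; omega
  have hN : ResolvableIncidence N k (l * (v - 1) / (k - 1)) l l₁ μ :=
    { col_sum := hcol
      row_sum := hr
      col_mul_self := fun i => by rw [hcol₂, Finset.inter_self, hEk]
      col_mul_same := fun i j hij hij' => by rw [hcol₂, hsame i j hij hij']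
      col_mul_ne := fun i j hij => by rw [hcol₂, hne i j hij, hl₂]
      row_mul_self := fun x => by simp only [hself, hr]
      row_mul := hrow }
  exact hN.designIsometry hm hn hμ (by rw [← hl₂]; exact_mod_cast hlk)

theorem corollary4p3 {P B : Type*} [Fintype P] [DecidableEq P] [Fintype B]
    (D : B → Finset P) (m n μ : ℕ) (hm : 2 ≤ m) (hn : 2 ≤ n) (hμ : 0 < μ)
    (hD : IsStronglyResolvable D m n μ) :
    -- (a1)
    (Even m → IsSquare (m * n - m + 1)) ∧
    -- (a2)
    (Odd m → Even n → IsSquare ((m * n - m + 1) * μ)) ∧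
    -- (a3)
    (Odd m → Odd n → IsSquare (n * (m * n - m + 1))) ∧
    -- (b1)
    (m ≡ 2 [MOD 4] → ∃ a b : ℕ, n = a ^ 2 + b ^ 2) ∧
    -- (b2)
    (m ≡ 3 [MOD 4] → n ≡ 2 [MOD 4] → ∃ a b : ℕ, n = a ^ 2 + b ^ 2) ∧
    -- (b3)
    (m ≡ 3 [MOD 4] → n ≡ 0 [MOD 4] → ∃ a b : ℕ, m * n - m + 1 = a ^ 2 + b ^ 2) ∧
    -- (b4)
    (m ≡ 1 [MOD 4] → n ≡ 2 [MOD 4] → ∃ a b : ℕ, n * (m * n - m + 1) = a ^ 2 + b ^ 2) ∧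
    -- (b5)
    (Odd m → Odd n → ¬ m ≡ n [MOD 4] →
      ∃ x y z : ℤ, (x, y, z) ≠ (0, 0, 0) ∧
        (μ : ℤ) * x ^ 2 + (-1) ^ ((n - 1) / 2) * (n : ℤ) * y ^ 2 = z ^ 2) ∧
    -- (b6)
    (m ≡ 1 [MOD 4] → n ≡ 1 [MOD 4] →
      ∃ x y z : ℤ, (x, y, z) ≠ (0, 0, 0) ∧ (n : ℤ) * x ^ 2 - (μ : ℤ) * y ^ 2 = z ^ 2) ∧
    -- (b7)
    (m ≡ 3 [MOD 4] → n ≡ 3 [MOD 4] → ∀ (p : ℕ) [Fact p.Prime],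
      padicHilbertSymbol p (-(μ : ℚ)) (-(n : ℚ)) = if p = 2 then -1 else 1) := by
  have h := hD.designIsometry hm hn hμ
  refine ⟨h.isSquare_of_even, h.isSquare_of_odd_of_even, h.isSquare_of_odd_of_odd,
    h.two_squares_of_two_mod_four, h.two_squares_of_three_of_two,
    h.two_squares_of_three_of_zero, h.two_squares_of_one_of_two, h.exists_zero_of_odd_of_ne,
    h.exists_zero_of_one_of_one, h.padicHilbertSymbol_eq⟩
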